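/- Let $\mathcal{G}$ be a (finite-dimensional, real, smooth) abelian Lie group with a bi-invariant Riemannian metric $g$, i.e. a smooth Riemannian metric for which all left and right translations are isometries. For $a\in\mathcal{G}$ let $\ell_a(x)=a\cdot x$ denote left translation. Let $p,q\in\mathcal{G}$ and let $\gamma:[0,1]\to\mathcal{G}$ be any geodesic of $g$ with $\gamma(0)=p$ and $\gamma(1)=q$. Then for every $u\in T_p\mathcal{G}$ the parallel transport $\tau_{p,q}(u)\in T_q\mathcal{G}$ of $u$ along $\gamma$ with respect to the Levi-Civita connection of $g$ (that is, $\tau_{p,q}(u)=V(1)$ for the smooth vector field $V$ along $\gamma$ with $D_tV=0$ and $V(0)=u$) exists, is unique, and is given by $$\tau_{p,q}(u)=(d\ell_{q\cdot p^{-1}})_p\,u .$$ -/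

import Mathlib

open Set
open scoped Manifold ContDiff

noncomputable section

section Riemannian

variable {E : Type*} [NormedAddCommGroup E] [NormedSpace ℝ E]
  {H : Type*} [TopologicalSpace H] {I : ModelWithCorners ℝ E H}
  {M : Type*} [TopologicalSpace M] [ChartedSpace H M] [IsManifold I ∞ M]

/-- The coordinate expression of the Riemannian metric `g` in the chart around `x`, as a function
on the model space: at a point `y` of the chart target, lying over `p`, it is the bilinear form
`(u, v) ↦ g_p (T u, T v)`, where `T : E → T_p M` is the inverse of the trivialization of the tangent
bundle given by the differential of the chart. -/
def metricInChart (g : Bundle.ContMDiffRiemannianMetric I ∞ E (fun p : M ↦ TangentSpace I p)) (x : M)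
    (y : E) : E →L[ℝ] E →L[ℝ] ℝ :=
  let p : M := (extChartAt I x).symm y
  let B : E →L[ℝ] E →L[ℝ] ℝ := g.inner p
  let T : E →L[ℝ] E := (trivializationAt E (fun p : M ↦ TangentSpace I p) x).symmL ℝ p
  B.bilinearComp T T

/-- The Christoffel symbol of the first kind of the Levi-Civita connection of `g`, at `x` in the
chart around `x`, as the linear form
`w ↦ 1/2 (∂_u g (v, w) + ∂_v g (u, w) - ∂_w g (u, v))`.
The model space is the tangent space at `x`, through the chart around `x`. -/
def christoffelForm (g : Bundle.ContMDiffRiemannianMetric I ∞ E (fun p : M ↦ TangentSpace I p)) (x : M)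
    (u v : TangentSpace I x) : TangentSpace I x →L[ℝ] ℝ :=
  let D : E →L[ℝ] E →L[ℝ] E →L[ℝ] ℝ := fderiv ℝ (metricInChart g x) (extChartAt I x x)
  let u₀ : E := u
  let v₀ : E := v
  let Γ : E →L[ℝ] ℝ := (1 / 2 : ℝ) • (D u₀ v₀ + D v₀ u₀ - (D.flip u₀).flip v₀)
  Γ

/-- The Christoffel symbol (of the second kind) `Γ (u, v)` of the Levi-Civita connection of `g`, at
`x` in the chart around `x`: the vector that represents `christoffelForm g x u v` with respect to
the inner product `g_x` (see `inner_christoffel`). -/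
def christoffel (g : Bundle.ContMDiffRiemannianMetric I ∞ E (fun p : M ↦ TangentSpace I p)) (x : M)
    (u v : TangentSpace I x) : TangentSpace I x :=
  (g.inner x).inverse (christoffelForm g x u v)

theorem inner_christoffel [FiniteDimensional ℝ E]
    (g : Bundle.ContMDiffRiemannianMetric I ∞ E (fun p : M ↦ TangentSpace I p)) (x : M)
    (u v w : TangentSpace I x) :
    g.inner x (christoffel g x u v) w = christoffelForm g x u v w := by
  let L : E →L[ℝ] (E →L[ℝ] ℝ) := g.inner x
  have hL : Function.Injective L.toLinearMap := by
    rw [← LinearMap.ker_eq_bot, LinearMap.ker_eq_bot']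
    intro a ha
    by_contra h
    have h1 := g.pos x a h
    have h2 : L a a = 0 := by
      have : L a = 0 := ha
      rw [this]; rfl
    exact h1.ne' h2
  have hdim : Module.finrank ℝ E = Module.finrank ℝ (E →L[ℝ] ℝ) := by
    rw [← LinearEquiv.finrank_eq (LinearMap.toContinuousLinearMap (𝕜 := ℝ) (E := E) (F' := ℝ))]
    exact (Subspace.dual_finrank_eq (K := ℝ) (V := E)).symm
  let e : E ≃L[ℝ] (E →L[ℝ] ℝ) :=
    (LinearEquiv.ofInjectiveOfFinrankEq L.toLinearMap hL hdim).toContinuousLinearEquiv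
  have he : (e : E →L[ℝ] (E →L[ℝ] ℝ)) = L := by
    ext a b; rfl
  have hinv : L.inverse = (e.symm : (E →L[ℝ] ℝ) →L[ℝ] E) := by
    rw [← he]; exact ContinuousLinearMap.inverse_equiv e
  have key : ∀ φ : E →L[ℝ] ℝ, L (L.inverse φ) = φ := by
    intro φ
    rw [hinv]
    nth_rw 1 [← he]
    exact e.apply_symm_apply φ
  exact congrArg (fun φ : E →L[ℝ] ℝ ↦ φ w) (key (christoffelForm g x u v))

/-- The velocity `γ'(t)` of a curve `γ` parametrized by `[0, 1]` (one-sided at the end points). -/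
def curveVelocity (I : ModelWithCorners ℝ E H) (γ : ℝ → M) (t : ℝ) : TangentSpace I (γ t) :=
  mfderivWithin 𝓘(ℝ, ℝ) I γ (Icc 0 1) t (1 : ℝ)

/-- The covariant derivative `D_t V` of a vector field `V` along a curve `γ` parametrized by
`[0, 1]`, for the Levi-Civita connection of `g`: in the chart around `γ t` it is
`V' + Γ (γ', V)`. -/
def covDerivAlong (g : Bundle.ContMDiffRiemannianMetric I ∞ E (fun p : M ↦ TangentSpace I p))
    (γ : ℝ → M) (V : (t : ℝ) → TangentSpace I (γ t)) (t : ℝ) : TangentSpace I (γ t) :=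
  let V' : TangentSpace I (γ t) := derivWithin (fun s ↦
    (trivializationAt E (fun p : M ↦ TangentSpace I p) (γ t)).continuousLinearMapAt ℝ (γ s) (V s))
    (Icc 0 1) t
  V' + christoffel g (γ t) (curveVelocity I γ t) (V t)

/-- `V` is a smooth parallel vector field along the curve `γ` parametrized by `[0, 1]`. -/
structure IsParallelAlong (g : Bundle.ContMDiffRiemannianMetric I ∞ E (fun p : M ↦ TangentSpace I p))
    (γ : ℝ → M) (V : (t : ℝ) → TangentSpace I (γ t)) : Prop where
  smooth : ContMDiffOn 𝓘(ℝ, ℝ) I.tangent ∞ (fun t ↦ (⟨γ t, V t⟩ : TangentBundle I M)) (Icc 0 1)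
  parallel : ∀ t ∈ Icc (0 : ℝ) 1, covDerivAlong g γ V t = 0

/-- `γ` is a geodesic parametrized by `[0, 1]`: a smooth curve whose velocity is parallel. -/
structure IsGeodesic (g : Bundle.ContMDiffRiemannianMetric I ∞ E (fun p : M ↦ TangentSpace I p))
    (γ : ℝ → M) : Prop where
  smooth : ContMDiffOn 𝓘(ℝ, ℝ) I ∞ γ (Icc 0 1)
  parallel_velocity : IsParallelAlong g γ (curveVelocity I γ)

/-- `b` is the parallel transport of the tangent vector `a` along `γ` from `γ 0` to `γ 1`: some
parallel vector field along `γ` starts at `a` and ends at `b`. -/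
def IsParallelTransport (g : Bundle.ContMDiffRiemannianMetric I ∞ E (fun p : M ↦ TangentSpace I p))
    (γ : ℝ → M) (a b : TangentBundle I M) : Prop :=
  ∃ V : (t : ℝ) → TangentSpace I (γ t), IsParallelAlong g γ V ∧
    (⟨γ 0, V 0⟩ : TangentBundle I M) = a ∧ (⟨γ 1, V 1⟩ : TangentBundle I M) = b

end Riemannian

/-- A Riemannian metric on a Lie group is bi-invariant: left and right translations are
isometries. -/
structure IsBiInvariantMetric {E : Type*} [NormedAddCommGroup E] [NormedSpace ℝ E]
    {H : Type*} [TopologicalSpace H] {I : ModelWithCorners ℝ E H}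
    {G : Type*} [TopologicalSpace G] [ChartedSpace H G] [Group G] [LieGroup I ∞ G]
    (g : Bundle.ContMDiffRiemannianMetric I ∞ E (fun p : G ↦ TangentSpace I p)) : Prop where
  left_invariant : ∀ (a x : G) (u v : TangentSpace I x),
    g.inner (a * x) (mfderiv I I (fun y ↦ a * y) x u) (mfderiv I I (fun y ↦ a * y) x v) =
      g.inner x u v
  right_invariant : ∀ (a x : G) (u v : TangentSpace I x),
    g.inner (x * a) (mfderiv I I (fun y ↦ y * a) x u) (mfderiv I I (fun y ↦ y * a) x v) =
      g.inner x u v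

end

/-! On an abelian group the left-invariant vector fields are parallel. Around `x₀`, write `F(y)` for
the left-invariant frame in the chart, normalised to the identity at the centre `y₀`, and `A` for
its derivative at `y₀`. Since `g(F u, F v)` is constant, `A` determines the first derivatives of the
metric (`fderiv_metricInChart`). Since the product is commutative, `A` is a mixed second derivative
of a symmetric function, so `A u v = A v u` (`fderiv_invariantFrame_comm`). The Koszul formula then
collapses to `Γ = -A` (`christoffel_eq_neg_fderiv_invariantFrame`).

Along a curve, the left translates of a fixed vector have coordinate derivative `A γ' V`, which `Γ`
cancels; this gives existence. For uniqueness, the inner product of two parallel fields is constant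
(`IsParallelAlong.inner_eq`), and the left translates fill the tangent space at the end point, so
nondegeneracy of `g` fixes the end value. -/

noncomputable section

section InvariantFrame

open ContinuousLinearMap

variable {E : Type*} [NormedAddCommGroup E] [NormedSpace ℝ E]
  {H : Type*} [TopologicalSpace H] {I : ModelWithCorners ℝ E H}
  {G : Type*} [TopologicalSpace G] [ChartedSpace H G]

/-- The differential at `x` of the left translation by `a`, with both tangent spaces identified
with the model space. -/
def leftTranslationDeriv [Group G] (I : ModelWithCorners ℝ E H) (a x : G) : E →L[ℝ] E :=
  mfderiv I I (fun y ↦ a * y) x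

/-- The trivialization over `x` of the tangent bundle around `x₀`, with the tangent space at `x`
identified with the model space. -/
def tangentCoord (I : ModelWithCorners ℝ E H) [IsManifold I 1 G] (x₀ x : G) : E →L[ℝ] E :=
  (trivializationAt E (fun p : G ↦ TangentSpace I p) x₀).continuousLinearMapAt ℝ x

/-- The map `(x, z) ↦ x * x₀⁻¹ * z` read in the chart around `x₀`. -/
def mulInChart [Group G] (I : ModelWithCorners ℝ E H) (x₀ : G) (w : E × E) : E :=
  extChartAt I x₀ ((extChartAt I x₀).symm w.1 * x₀⁻¹ * (extChartAt I x₀).symm w.2)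

/-- The left-invariant frame which is the identity at `x₀`, read in the chart around `x₀`. -/
def invariantFrame [Group G] (I : ModelWithCorners ℝ E H) (x₀ : G) (y : E) : E →L[ℝ] E :=
  (fderiv ℝ (mulInChart I x₀) (y, extChartAt I x₀ x₀)).comp (inr ℝ E E)

/-! ### The metric in chart coordinates -/

section Metric

variable [IsManifold I ∞ G]

/-- Moves between base points that are equal but not definitionally so, with the vectors held fixed
in `E`. -/
theorem metric_congr (g : Bundle.ContMDiffRiemannianMetric I ∞ E (fun x : G ↦ TangentSpace I x))
    {x z : G} (h : x = z) (u v : E) :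
    (g.inner x : E →L[ℝ] E →L[ℝ] ℝ) u v = (g.inner z : E →L[ℝ] E →L[ℝ] ℝ) u v := by
  subst h; rfl

theorem tangentCoord_self (x₀ : G) : tangentCoord I x₀ x₀ = .id ℝ E :=
  (TangentBundle.continuousLinearMapAt_trivializationAt (mem_chart_source H x₀)).trans
    mfderiv_extChartAt_self

theorem metricInChart_tangentCoord
    (g : Bundle.ContMDiffRiemannianMetric I ∞ E (fun x : G ↦ TangentSpace I x))
    {x₀ x : G} (hx : x ∈ (extChartAt I x₀).source) (u v : E) :
    metricInChart g x₀ (extChartAt I x₀ x) (tangentCoord I x₀ x u) (tangentCoord I x₀ x v) =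
      g.inner x u v := by
  have h := (extChartAt I x₀).left_inv hx
  have hb : x ∈ (trivializationAt E (fun p : G ↦ TangentSpace I p) x₀).baseSet := by
    rw [extChartAt_source] at hx
    exact hx
  have hT : ∀ w : E, (trivializationAt E (fun p : G ↦ TangentSpace I p) x₀).symmL ℝ x
      (tangentCoord I x₀ x w) = w := fun w ↦
    (trivializationAt E (fun p : G ↦ TangentSpace I p) x₀).symmL_continuousLinearMapAt hb w
  conv_rhs => rw [← hT u, ← hT v]
  unfold metricInChart
  rw [h]
  rfl

theorem metric_ext (g : Bundle.ContMDiffRiemannianMetric I ∞ E (fun x : G ↦ TangentSpace I x))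
    (x : G) {a b : E} (h : ∀ w : E, (g.inner x : E →L[ℝ] E →L[ℝ] ℝ) a w =
      (g.inner x : E →L[ℝ] E →L[ℝ] ℝ) b w) : a = b := by
  let B : E →L[ℝ] E →L[ℝ] ℝ := g.inner x
  by_contra hne
  have h1 : 0 < B (a - b) (a - b) := g.pos x _ (sub_ne_zero.2 hne)
  have h2 : B (a - b) (a - b) = 0 := by
    rw [B.map_sub₂, sub_eq_zero]
    exact h _
  exact h1.ne' h2

end Metric

/-! ### The left-invariant frame and the derivative of the metric -/

section Group

variable [Group G] [LieGroup I ∞ G]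

theorem mdifferentiableAt_mul_left_infty (a x : G) : MDifferentiableAt I I (fun y ↦ a * y) x :=
  (contMDiff_mul_left (I := I) (n := ∞)).contMDiffAt.mdifferentiableAt (by simp)

theorem leftTranslationDeriv_mul (a b x : G) :
    leftTranslationDeriv I (a * b) x =
      (leftTranslationDeriv I a (b * x)).comp (leftTranslationDeriv I b x) := by
  have h : (fun y : G ↦ a * b * y) = (fun y ↦ a * y) ∘ (fun y ↦ b * y) := by
    ext y; simp [mul_assoc]
  unfold leftTranslationDeriv
  rw [h]
  exact mfderiv_comp x (mdifferentiableAt_mul_left_infty a (b * x))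
    (mdifferentiableAt_mul_left_infty b x)

omit [LieGroup I ∞ G] in
theorem leftTranslationDeriv_one (x : G) : leftTranslationDeriv I 1 x = .id ℝ E := by
  have h : (fun y : G ↦ 1 * y) = id := by ext y; simp
  unfold leftTranslationDeriv
  rw [h]
  exact mfderiv_id

variable [I.Boundaryless]

theorem contDiffAt_mulInChart (x₀ : G) {y : E} (hy : y ∈ (extChartAt I x₀).target) :
    ContDiffAt ℝ ∞ (mulInChart I x₀) (y, extChartAt I x₀ x₀) := by
  have hsymm : ∀ z ∈ (extChartAt I x₀).target,
      ContMDiffAt 𝓘(ℝ, E) I ∞ (extChartAt I x₀).symm z := fun z hz ↦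
    (contMDiffOn_extChartAt_symm x₀).contMDiffAt (extChartAt_target_mem_nhds' hz)
  have h1 : ContMDiffAt 𝓘(ℝ, E × E) I ∞ (fun w : E × E ↦ (extChartAt I x₀).symm w.1)
      (y, extChartAt I x₀ x₀) :=
    ContMDiffAt.comp (I' := 𝓘(ℝ, E)) (g := (extChartAt I x₀).symm) (f := Prod.fst)
      (y, extChartAt I x₀ x₀) (hsymm y hy) contDiff_fst.contMDiff.contMDiffAt
  have h2 : ContMDiffAt 𝓘(ℝ, E × E) I ∞ (fun w : E × E ↦ (extChartAt I x₀).symm w.2)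
      (y, extChartAt I x₀ x₀) :=
    ContMDiffAt.comp (I' := 𝓘(ℝ, E)) (g := (extChartAt I x₀).symm) (f := Prod.snd)
      (y, extChartAt I x₀ x₀) (hsymm _ (mem_extChartAt_target x₀))
      contDiff_snd.contMDiff.contMDiffAt
  have h3 := (h1.mul (contMDiffAt_const (c := x₀⁻¹))).mul h2
  refine ContMDiffAt.contDiffAt ?_
  refine ContMDiffAt.comp (I' := I) (g := extChartAt I x₀) _ ?_ h3
  refine contMDiffAt_extChartAt' ?_
  -- At the base point the product is `x * x₀⁻¹ * x₀ = x`, which lies in the chart domain.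
  have := (extChartAt I x₀).map_target hy
  rw [extChartAt_source] at this
  simpa using this

theorem contDiffAt_invariantFrame (x₀ : G) :
    ContDiffAt ℝ ∞ (invariantFrame I x₀) (extChartAt I x₀ x₀) := by
  have h1 : ContDiffAt ℝ ∞ (fderiv ℝ (mulInChart I x₀))
      (extChartAt I x₀ x₀, extChartAt I x₀ x₀) :=
    (contDiffAt_mulInChart x₀ (mem_extChartAt_target x₀)).fderiv_right (by simp)
  have h2 : ContDiffAt ℝ ∞ (fun y : E ↦ (y, extChartAt I x₀ x₀)) (extChartAt I x₀ x₀) :=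
    contDiffAt_id.prodMk contDiffAt_const
  exact (ContDiffAt.comp (f := fun y : E ↦ (y, extChartAt I x₀ x₀)) (extChartAt I x₀ x₀)
    h1 h2).clm_comp contDiffAt_const

/-- Chain rule: with the first factor frozen at `x`, `mulInChart` is the chart after left
translation by `x * x₀⁻¹` after the inverse chart, whose differential at the centre is the identity.
-/
theorem invariantFrame_extChartAt {x₀ x : G} (hx : x ∈ (extChartAt I x₀).source) :
    invariantFrame I x₀ (extChartAt I x₀ x) =
      (tangentCoord I x₀ x).comp (leftTranslationDeriv I (x * x₀⁻¹) x₀) := by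
  set y₀ := extChartAt I x₀ x₀
  set y := extChartAt I x₀ x
  have hF : HasFDerivAt (fun z : E ↦ mulInChart I x₀ (y, z)) (invariantFrame I x₀ y) y₀ := by
    have h := ((contDiffAt_mulInChart x₀ ((extChartAt I x₀).map_source hx)).differentiableAt
      (by simp)).hasFDerivAt
    exact HasFDerivAt.comp y₀ h (hasFDerivAt_prodMk_right y y₀)
  have hs : HasMFDerivAt 𝓘(ℝ, E) I (extChartAt I x₀).symm y₀ (.id ℝ E) := by
    have h := (mdifferentiableWithinAt_extChartAt_symm (I := I)
      (mem_extChartAt_target (I := I) x₀)).hasMFDerivWithinAt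
    rw [mfderivWithin_range_extChartAt_symm, I.range_eq_univ] at h
    exact hasMFDerivWithinAt_univ.1 h
  have hl := (mdifferentiableAt_mul_left_infty (I := I) (x * x₀⁻¹)
    ((extChartAt I x₀).symm y₀)).hasMFDerivAt
  have hx' : x * x₀⁻¹ * (extChartAt I x₀).symm y₀ = x := by simp [y₀]
  let T : E →L[ℝ] E := tangentCoord I x₀ x
  have hc : HasMFDerivAt I 𝓘(ℝ, E) (extChartAt I x₀) (x * x₀⁻¹ * (extChartAt I x₀).symm y₀) T := by
    rw [hx']
    rw [extChartAt_source] at hx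
    have hT : T = mfderiv I 𝓘(ℝ, E) (extChartAt I x₀) x :=
      TangentBundle.continuousLinearMapAt_trivializationAt hx
    rw [hT]
    exact (mdifferentiableAt_extChartAt hx).hasMFDerivAt
  have h := (hc.comp y₀ (hl.comp y₀ hs)).hasFDerivAt
  have e : ((extChartAt I x₀) ∘ (fun z ↦ x * x₀⁻¹ * z) ∘ (extChartAt I x₀).symm) =
      (fun z : E ↦ mulInChart I x₀ (y, z)) := by
    ext z
    simp only [mulInChart, y, (extChartAt I x₀).left_inv hx, Function.comp_apply]
  rw [e] at h
  rw [hF.unique h]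
  have : (extChartAt I x₀).symm y₀ = x₀ := by simp [y₀]
  rw [this]
  rfl

theorem invariantFrame_self (x₀ : G) : invariantFrame I x₀ (extChartAt I x₀ x₀) = .id ℝ E := by
  rw [invariantFrame_extChartAt (mem_extChartAt_source x₀), tangentCoord_self, mul_inv_cancel,
    leftTranslationDeriv_one]
  rfl

theorem differentiableAt_invariantFrame (x₀ : G) :
    DifferentiableAt ℝ (invariantFrame I x₀) (extChartAt I x₀ x₀) :=
  (contDiffAt_invariantFrame x₀).differentiableAt (by simp)

/-- Left translation by `x * x₀⁻¹` is an isometry carrying `x₀` to `x`, so the right-hand side does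
not depend on `x`. -/
theorem metricInChart_invariantFrame
    {g : Bundle.ContMDiffRiemannianMetric I ∞ E (fun x : G ↦ TangentSpace I x)}
    (hg : IsBiInvariantMetric g) {x₀ x : G} (hx : x ∈ (extChartAt I x₀).source) (u v : E) :
    metricInChart g x₀ (extChartAt I x₀ x) (invariantFrame I x₀ (extChartAt I x₀ x) u)
      (invariantFrame I x₀ (extChartAt I x₀ x) v) = g.inner x₀ u v := by
  rw [invariantFrame_extChartAt hx, comp_apply, comp_apply, metricInChart_tangentCoord g hx,
    ← hg.left_invariant (x * x₀⁻¹) x₀ u v]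
  exact metric_congr g (by group) _ _

theorem metricInChart_self
    {g : Bundle.ContMDiffRiemannianMetric I ∞ E (fun x : G ↦ TangentSpace I x)}
    (hg : IsBiInvariantMetric g) (x₀ : G) :
    metricInChart g x₀ (extChartAt I x₀ x₀) = g.inner x₀ := by
  ext u v
  have h := metricInChart_invariantFrame hg (mem_extChartAt_source x₀) u v
  rwa [invariantFrame_self] at h

variable [CompleteSpace E]

theorem differentiableAt_metricInChart
    {g : Bundle.ContMDiffRiemannianMetric I ∞ E (fun x : G ↦ TangentSpace I x)}
    (hg : IsBiInvariantMetric g) (x₀ : G) :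
    DifferentiableAt ℝ (metricInChart g x₀) (extChartAt I x₀ x₀) := by
  set y₀ := extChartAt I x₀ x₀ with hy₀
  let B : E →L[ℝ] E →L[ℝ] ℝ := g.inner x₀
  have hinv : DifferentiableAt ℝ (fun y ↦ (invariantFrame I x₀ y).inverse) y₀ := by
    have h : ContDiffAt ℝ 1 inverse (invariantFrame I x₀ y₀) := by
      rw [hy₀, invariantFrame_self]
      exact contDiffAt_map_inverse (ContinuousLinearEquiv.refl ℝ E)
    exact (h.differentiableAt (by simp)).comp y₀ (differentiableAt_invariantFrame x₀)
  have hev : ∀ᶠ y in nhds y₀, (invariantFrame I x₀ y).IsInvertible := by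
    have h : ∀ᶠ A in nhds (invariantFrame I x₀ y₀), A.IsInvertible := by
      rw [hy₀, invariantFrame_self]
      exact ContinuousLinearEquiv.nhds (ContinuousLinearEquiv.refl ℝ E)
    exact (differentiableAt_invariantFrame x₀).continuousAt.eventually h
  -- Near `y₀` the frame is invertible, so the metric is the fixed form `B` pulled back by the
  -- inverse frame; its regularity follows from that of the frame.
  have heq : metricInChart g x₀ =ᶠ[nhds y₀] fun y ↦
      ((compL ℝ E E ℝ).flip (invariantFrame I x₀ y).inverse).comp
        (B.comp (invariantFrame I x₀ y).inverse) := by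
    filter_upwards [hev, extChartAt_target_mem_nhds (I := I) x₀] with y ⟨e, he⟩ hy
    ext u v
    have h := metricInChart_invariantFrame hg ((extChartAt I x₀).map_target hy)
      (e.symm u) (e.symm v)
    rw [(extChartAt I x₀).right_inv hy, ← he] at h
    rw [← he]
    simpa using! h
  refine DifferentiableAt.congr_of_eventuallyEq ?_ heq
  exact ((compL ℝ E E ℝ).flip.differentiableAt.comp y₀ hinv).clm_comp
    ((differentiableAt_const B).clm_comp hinv)

/-- Product rule applied to the constant `g(F u, F v)` at the centre, where `F` is the identity. -/
theorem fderiv_metricInChart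
    {g : Bundle.ContMDiffRiemannianMetric I ∞ E (fun x : G ↦ TangentSpace I x)}
    (hg : IsBiInvariantMetric g) (x₀ : G) (w u v : E) :
    fderiv ℝ (metricInChart g x₀) (extChartAt I x₀ x₀) w u v =
      -(g.inner x₀ (fderiv ℝ (invariantFrame I x₀) (extChartAt I x₀ x₀) w u) v +
        g.inner x₀ u (fderiv ℝ (invariantFrame I x₀) (extChartAt I x₀ x₀) w v)) := by
  set y₀ := extChartAt I x₀ x₀ with hy₀
  have hF := (differentiableAt_invariantFrame (I := I) x₀).hasFDerivAt
  have hM := (differentiableAt_metricInChart hg x₀).hasFDerivAt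
  have hd := (hM.clm_apply (hF.clm_apply (hasFDerivAt_const u y₀))).clm_apply
    (hF.clm_apply (hasFDerivAt_const v y₀))
  have hc : (fun y ↦ metricInChart g x₀ y (invariantFrame I x₀ y u) (invariantFrame I x₀ y v))
      =ᶠ[nhds y₀] fun _ ↦ (g.inner x₀ : E →L[ℝ] E →L[ℝ] ℝ) u v := by
    filter_upwards [extChartAt_target_mem_nhds (I := I) x₀] with y hy
    have h := metricInChart_invariantFrame hg ((extChartAt I x₀).map_target hy) u v
    rwa [(extChartAt I x₀).right_inv hy] at h
  have h := congrArg (fun L : E →L[ℝ] ℝ ↦ L w)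
    (hd.unique ((hasFDerivAt_const _ _).congr_of_eventuallyEq hc))
  simp only [← hy₀] at h
  rw [metricInChart_self hg, invariantFrame_self] at h
  simp only [comp_zero, zero_add, id_apply, add_apply, flip_apply, coe_comp, Function.comp_apply,
    zero_apply] at h
  let B : E →L[ℝ] E →L[ℝ] ℝ := g.inner x₀
  have h' : B u (fderiv ℝ (invariantFrame I x₀) y₀ w v) +
    (B (fderiv ℝ (invariantFrame I x₀) y₀ w u) v +
      fderiv ℝ (metricInChart g x₀) y₀ w u v) = 0 := h
  change _ = -(B (fderiv ℝ (invariantFrame I x₀) y₀ w u) v +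
    B u (fderiv ℝ (invariantFrame I x₀) y₀ w v))
  linarith

end Group

/-! ### Commutativity and the Christoffel symbols -/

section CommGroup

variable [CommGroup G] [LieGroup I ∞ G] [I.Boundaryless]

omit [LieGroup I ∞ G] [I.Boundaryless] in
theorem mulInChart_swap (x₀ : G) (w : E × E) : mulInChart I x₀ w.swap = mulInChart I x₀ w := by
  simp only [mulInChart, Prod.fst_swap, Prod.snd_swap]
  congr 1
  rw [mul_right_comm, mul_comm (_ * _) x₀⁻¹, mul_comm (extChartAt I x₀ |>.symm w.2), mul_comm x₀⁻¹,
    mul_right_comm]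

/-- Both sides are mixed second derivatives of `mulInChart`, on `(u, 0), (0, v)` and on `(v, 0), (0,
u)`. The swap symmetry, which is where commutativity enters, together with the symmetry of second
derivatives exchanges them. -/
theorem fderiv_invariantFrame_comm (x₀ : G) (u v : E) :
    fderiv ℝ (invariantFrame I x₀) (extChartAt I x₀ x₀) u v =
      fderiv ℝ (invariantFrame I x₀) (extChartAt I x₀ x₀) v u := by
  set y₀ := extChartAt I x₀ x₀ with hy₀
  set F := mulInChart I x₀
  have hF : ContDiffAt ℝ ∞ F (y₀, y₀) := contDiffAt_mulInChart x₀ (mem_extChartAt_target x₀)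
  have hF' : DifferentiableAt ℝ (fderiv ℝ F) (y₀, y₀) :=
    (hF.fderiv_right (m := ∞) (by simp)).differentiableAt (by simp)
  have hA : ∀ a b : E, fderiv ℝ (invariantFrame I x₀) y₀ a b =
      fderiv ℝ (fderiv ℝ F) (y₀, y₀) (a, 0) (0, b) := by
    intro a b
    have h1 : HasFDerivAt (fun y : E ↦ fderiv ℝ F (y, y₀))
        ((fderiv ℝ (fderiv ℝ F) (y₀, y₀)).comp (inl ℝ E E)) y₀ :=
      HasFDerivAt.comp (f := fun y : E ↦ (y, y₀)) y₀ hF'.hasFDerivAt (hasFDerivAt_prodMk_left y₀ y₀)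
    have h2 := h1.clm_comp (hasFDerivAt_const (inr ℝ E E) y₀)
    have h3 : fderiv ℝ (invariantFrame I x₀) y₀ = _ := h2.fderiv
    rw [h3]
    simp
  have hsymm : IsSymmSndFDerivAt ℝ F (y₀, y₀) := hF.isSymmSndFDerivAt (by
    rw [minSmoothness_of_isRCLikeNormedField]
    exact WithTop.coe_le_coe.2 le_top)
  let S : (E × E) ≃L[ℝ] (E × E) := ContinuousLinearEquiv.prodComm ℝ E E
  have hFS : F ∘ S = F := by
    ext w
    exact mulInChart_swap x₀ w
  have hd : ∀ w, fderiv ℝ F w = (fderiv ℝ F (S w)).comp (S : E × E →L[ℝ] E × E) := by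
    intro w
    conv_lhs => rw [← hFS]
    exact S.comp_right_fderiv
  have hswap : ∀ a b : E × E, fderiv ℝ (fderiv ℝ F) (y₀, y₀) a b =
      fderiv ℝ (fderiv ℝ F) (y₀, y₀) (S a) (S b) := by
    intro a b
    have h1 : HasFDerivAt (fun w ↦ fderiv ℝ F (S w))
        ((fderiv ℝ (fderiv ℝ F) (y₀, y₀)).comp (S : E × E →L[ℝ] E × E)) (y₀, y₀) :=
      HasFDerivAt.comp (f := S) (y₀, y₀) hF'.hasFDerivAt S.hasFDerivAt
    have h2 := h1.clm_comp (hasFDerivAt_const (S : E × E →L[ℝ] E × E) (y₀, y₀))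
    rw [← funext hd] at h2
    have h3 := h2.fderiv
    conv_lhs => rw [h3]
    simp
  rw [hA, hA, hswap, hsymm.eq]
  simp [S]

variable [FiniteDimensional ℝ E]

theorem christoffel_eq_neg_fderiv_invariantFrame
    {g : Bundle.ContMDiffRiemannianMetric I ∞ E (fun x : G ↦ TangentSpace I x)}
    (hg : IsBiInvariantMetric g) (x₀ : G) (u v : E) :
    christoffel g x₀ u v = -fderiv ℝ (invariantFrame I x₀) (extChartAt I x₀ x₀) u v := by
  have : CompleteSpace E := FiniteDimensional.complete ℝ E
  set A := fderiv ℝ (invariantFrame I x₀) (extChartAt I x₀ x₀) with hA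
  let B : E →L[ℝ] E →L[ℝ] ℝ := g.inner x₀
  have hBs : ∀ a b, B a b = B b a := g.symm x₀
  let c : E := christoffel g x₀ u v
  have hc : ∀ w : E, B c w = B (-A u v) w := by
    intro w
    have h : B c w = (1 / 2 : ℝ) * (fderiv ℝ (metricInChart g x₀) (extChartAt I x₀ x₀) u v w +
        fderiv ℝ (metricInChart g x₀) (extChartAt I x₀ x₀) v u w -
        fderiv ℝ (metricInChart g x₀) (extChartAt I x₀ x₀) w u v) :=
      inner_christoffel g x₀ u v w
    have hD : ∀ a b d : E, fderiv ℝ (metricInChart g x₀) (extChartAt I x₀ x₀) a b d =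
      -(B (A a b) d + B b (A a d)) := fderiv_metricInChart hg x₀
    have hAc : ∀ a b : E, A a b = A b a := fderiv_invariantFrame_comm x₀
    -- Once `A` is symmetric, the terms in `A u w` and `A v w` cancel and `B (A u v) w` is counted
    -- twice, absorbing the factor `1 / 2`.
    rw [h, hD, hD, hD, hAc v u, hAc w u, hAc w v, hBs (A u w) v]
    simp only [map_neg, neg_apply]
    ring
  exact metric_ext g x₀ hc

end CommGroup

end InvariantFrame

/-! ### Parallel fields along a curve -/

section ParallelTransport

variable {E : Type*} [NormedAddCommGroup E] [NormedSpace ℝ E]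
  {H : Type*} [TopologicalSpace H] {I : ModelWithCorners ℝ E H}
  {G : Type*} [TopologicalSpace G] [ChartedSpace H G]

/-- The velocity of a curve, as an element of the model space. -/
def chartVelocity (I : ModelWithCorners ℝ E H) (γ : ℝ → G) (t : ℝ) : E :=
  curveVelocity I γ t

theorem hasDerivWithinAt_extChartAt_comp {γ : ℝ → G} {t : ℝ}
    (hγ : MDifferentiableWithinAt 𝓘(ℝ, ℝ) I γ (Icc 0 1) t) :
    HasDerivWithinAt (fun s ↦ extChartAt I (γ t) (γ s)) (chartVelocity I γ t) (Icc 0 1) t := by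
  let L : ℝ →L[ℝ] E := mfderivWithin 𝓘(ℝ, ℝ) I γ (Icc 0 1) t
  have h : HasFDerivWithinAt (fun s ↦ extChartAt I (γ t) (γ s)) L (Icc 0 1) t := by
    have h := hγ.hasMFDerivWithinAt.2
    simp only [writtenInExtChartAt, mfld_simps] at h
    exact h
  exact h.hasDerivWithinAt

/-- A vector field along a curve is smooth iff the curve is and the coordinates of the field are. -/
theorem contMDiffWithinAt_tangentBundle_iff [IsManifold I ∞ G] {γ : ℝ → G} (V : ℝ → E)
    {S : Set ℝ} {t : ℝ} :
    ContMDiffWithinAt 𝓘(ℝ, ℝ) I.tangent ∞ (fun s ↦ (⟨γ s, V s⟩ : TangentBundle I G)) S t ↔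
      ContMDiffWithinAt 𝓘(ℝ, ℝ) I ∞ γ S t ∧
        ContDiffWithinAt ℝ ∞ (fun s ↦ tangentCoord I (γ t) (γ s) (V s)) S t := by
  have hb : ∀ s, γ s ∈ (chartAt H (γ t)).source → tangentCoord I (γ t) (γ s) (V s) =
      (trivializationAt E (fun p : G ↦ TangentSpace I p) (γ t)
        (⟨γ s, V s⟩ : TangentBundle I G)).2 := fun s hs ↦
    congrFun ((trivializationAt E (fun p : G ↦ TangentSpace I p) (γ t)).coe_linearMapAt_of_mem
      (R := ℝ) hs) (V s)
  refine Bundle.contMDiffWithinAt_totalSpace.trans (and_congr_right fun hγ ↦ ?_)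
  rw [contMDiffWithinAt_iff_contDiffWithinAt]
  have hev : (fun s ↦ tangentCoord I (γ t) (γ s) (V s)) =ᶠ[nhdsWithin t S] fun s ↦
      (trivializationAt E (fun p : G ↦ TangentSpace I p) (γ t)
        (⟨γ s, V s⟩ : TangentBundle I G)).2 := by
    filter_upwards [hγ.continuousWithinAt (chart_source_mem_nhds H (γ t))] with s hs
    exact hb s hs
  have ht := hb t (mem_chart_source H _)
  exact ⟨fun h ↦ h.congr_of_eventuallyEq hev ht,
    fun h ↦ h.congr_of_eventuallyEq hev.symm ht.symm⟩

theorem totalSpace_mk_eq {x z : G} (h : x = z) {u v : E} (huv : u = v) :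
    (⟨x, u⟩ : TangentBundle I G) = ⟨z, v⟩ := by
  subst h huv; rfl

variable [CommGroup G] [LieGroup I ∞ G] [I.Boundaryless]

/-- In the chart around `x₀`, translating `u` from `p` to a varying `x` is the frame applied to a
vector independent of `x`; only the frame has to be differentiated. -/
theorem tangentCoord_leftTranslationDeriv {x₀ x : G} (hx : x ∈ (extChartAt I x₀).source)
    (p : G) (u : E) :
    tangentCoord I x₀ x (leftTranslationDeriv I (x * p⁻¹) p u) =
      invariantFrame I x₀ (extChartAt I x₀ x) (leftTranslationDeriv I (x₀ * p⁻¹) p u) := by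
  have h : x * p⁻¹ = (x * x₀⁻¹) * (x₀ * p⁻¹) := by group
  rw [h, leftTranslationDeriv_mul, invariantFrame_extChartAt hx, inv_mul_cancel_right]
  rfl

variable [FiniteDimensional ℝ E]

theorem covDerivAlong_eq
    {g : Bundle.ContMDiffRiemannianMetric I ∞ E (fun x : G ↦ TangentSpace I x)}
    (hg : IsBiInvariantMetric g) (γ : ℝ → G) (V : ℝ → E) (t : ℝ) :
    covDerivAlong g γ V t =
      derivWithin (fun s ↦ tangentCoord I (γ t) (γ s) (V s)) (Icc 0 1) t -
        fderiv ℝ (invariantFrame I (γ t)) (extChartAt I (γ t) (γ t)) (chartVelocity I γ t)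
          (V t) := by
  rw [sub_eq_add_neg]
  exact congrArg (derivWithin (fun s ↦ tangentCoord I (γ t) (γ s) (V s)) (Icc 0 1) t + ·)
    (christoffel_eq_neg_fderiv_invariantFrame hg (γ t) (chartVelocity I γ t) (V t))

theorem isParallelAlong_leftTranslationDeriv
    {g : Bundle.ContMDiffRiemannianMetric I ∞ E (fun x : G ↦ TangentSpace I x)}
    (hg : IsBiInvariantMetric g) {γ : ℝ → G} (hγ : ContMDiffOn 𝓘(ℝ, ℝ) I ∞ γ (Icc 0 1))
    (p : G) (u : E) :
    IsParallelAlong g γ (fun t ↦ leftTranslationDeriv I (γ t * p⁻¹) p u) := by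
  set V : ℝ → E := fun t ↦ leftTranslationDeriv I (γ t * p⁻¹) p u with hV
  have hev : ∀ t ∈ Icc (0 : ℝ) 1, (fun s ↦ tangentCoord I (γ t) (γ s) (V s))
      =ᶠ[nhdsWithin t (Icc 0 1)]
        fun s ↦ invariantFrame I (γ t) (extChartAt I (γ t) (γ s)) (V t) := fun t ht ↦ by
    filter_upwards [(hγ t ht).continuousWithinAt (extChartAt_source_mem_nhds (I := I) (γ t))]
      with s hs
    exact tangentCoord_leftTranslationDeriv hs p u
  refine ⟨fun t ht ↦ (contMDiffWithinAt_tangentBundle_iff V).2 ⟨hγ t ht, ?_⟩, fun t ht ↦ ?_⟩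
  · refine ContDiffWithinAt.congr_of_eventuallyEq ?_ (hev t ht) ((hev t ht).self_of_nhdsWithin ht)
    have hφ : ContDiffWithinAt ℝ ∞ (fun s ↦ extChartAt I (γ t) (γ s)) (Icc 0 1) t :=
      (contMDiffAt_extChartAt.comp_contMDiffWithinAt t (hγ t ht)).contDiffWithinAt
    exact ((contDiffAt_invariantFrame (γ t)).comp_contDiffWithinAt t hφ).clm_apply
      contDiffWithinAt_const
  · have hφ := hasDerivWithinAt_extChartAt_comp ((hγ t ht).mdifferentiableWithinAt (by simp))
    have h1 := (differentiableAt_invariantFrame (γ t)).hasFDerivAt.comp_hasDerivWithinAt t hφ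
    have h2 := (h1.clm_apply (hasDerivWithinAt_const t (Icc (0 : ℝ) 1) (V t))).congr_of_eventuallyEq
      (hev t ht) ((hev t ht).self_of_nhdsWithin ht)
    have h3 := h2.derivWithin (uniqueDiffOn_Icc zero_lt_one t ht)
    rw [map_zero, add_zero] at h3
    refine (covDerivAlong_eq hg γ V t).trans ?_
    rw [h3]
    exact sub_self _

theorem IsParallelAlong.hasDerivWithinAt_tangentCoord
    {g : Bundle.ContMDiffRiemannianMetric I ∞ E (fun x : G ↦ TangentSpace I x)}
    (hg : IsBiInvariantMetric g) {γ : ℝ → G} {V : ℝ → E}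
    (hV : IsParallelAlong g γ V) {t : ℝ} (ht : t ∈ Icc (0 : ℝ) 1) :
    HasDerivWithinAt (fun s ↦ tangentCoord I (γ t) (γ s) (V s))
      (fderiv ℝ (invariantFrame I (γ t)) (extChartAt I (γ t) (γ t)) (chartVelocity I γ t) (V t))
      (Icc 0 1) t := by
  have h := ((contMDiffWithinAt_tangentBundle_iff V).1 (hV.smooth t ht)).2.differentiableWithinAt
    (by simp) |>.hasDerivWithinAt
  rwa [sub_eq_zero.1 ((covDerivAlong_eq hg γ V t).symm.trans (hV.parallel t ht))] at h

/-- Metric compatibility: in the chart around `γ t`, the derivative of the metric contributes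
exactly minus the two terms coming from the derivatives of `V` and `W`. -/
theorem IsParallelAlong.inner_eq
    {g : Bundle.ContMDiffRiemannianMetric I ∞ E (fun x : G ↦ TangentSpace I x)}
    (hg : IsBiInvariantMetric g) {γ : ℝ → G} (hγ : ContMDiffOn 𝓘(ℝ, ℝ) I ∞ γ (Icc 0 1))
    {V W : ℝ → E} (hV : IsParallelAlong g γ V) (hW : IsParallelAlong g γ W) :
    (g.inner (γ 1) : E →L[ℝ] E →L[ℝ] ℝ) (V 1) (W 1) =
      (g.inner (γ 0) : E →L[ℝ] E →L[ℝ] ℝ) (V 0) (W 0) := by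
  have : CompleteSpace E := FiniteDimensional.complete ℝ E
  set f : ℝ → ℝ := fun s ↦ (g.inner (γ s) : E →L[ℝ] E →L[ℝ] ℝ) (V s) (W s) with hf
  have hd : ∀ t ∈ Icc (0 : ℝ) 1, HasDerivWithinAt f 0 (Icc 0 1) t := by
    intro t ht
    have hev : f =ᶠ[nhdsWithin t (Icc 0 1)] fun s ↦
        metricInChart g (γ t) (extChartAt I (γ t) (γ s)) (tangentCoord I (γ t) (γ s) (V s))
          (tangentCoord I (γ t) (γ s) (W s)) := by
      filter_upwards [(hγ t ht).continuousWithinAt (extChartAt_source_mem_nhds (I := I) (γ t))]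
        with s hs
      exact (metricInChart_tangentCoord g hs (V s) (W s)).symm
    refine HasDerivWithinAt.congr_of_eventuallyEq ?_ hev (hev.self_of_nhdsWithin ht)
    have hφ := hasDerivWithinAt_extChartAt_comp ((hγ t ht).mdifferentiableWithinAt (by simp))
    have hM := HasFDerivAt.comp_hasDerivWithinAt (l := metricInChart g (γ t)) t
      (differentiableAt_metricInChart hg (γ t)).hasFDerivAt hφ
    have h := (hM.clm_apply (hV.hasDerivWithinAt_tangentCoord hg ht)).clm_apply
      (hW.hasDerivWithinAt_tangentCoord hg ht)
    refine h.congr_deriv ?_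
    let B : E →L[ℝ] E →L[ℝ] ℝ := g.inner (γ t)
    let A : E →L[ℝ] E :=
      fderiv ℝ (invariantFrame I (γ t)) (extChartAt I (γ t) (γ t)) (chartVelocity I γ t)
    have hB : metricInChart g (γ t) (extChartAt I (γ t) (γ t)) = B := metricInChart_self hg (γ t)
    have hD : fderiv ℝ (metricInChart g (γ t)) (extChartAt I (γ t) (γ t)) (chartVelocity I γ t)
        (V t) (W t) = -(B (A (V t)) (W t) + B (V t) (A (W t))) :=
      fderiv_metricInChart hg (γ t) (chartVelocity I γ t) (V t) (W t)
    rw [tangentCoord_self, Function.comp_apply, hB]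
    simp only [add_apply, ContinuousLinearMap.id_apply]
    rw [hD]
    ring
  exact constant_of_derivWithin_zero (fun t ht ↦ (hd t ht).differentiableWithinAt)
    (fun t ht ↦ (hd t (Ico_subset_Icc_self ht)).derivWithin
      (uniqueDiffOn_Icc zero_lt_one t (Ico_subset_Icc_self ht))) 1 (right_mem_Icc.2 zero_le_one)

end ParallelTransport

end

theorem mainTheorem6
    {E : Type*} [NormedAddCommGroup E] [NormedSpace ℝ E] [FiniteDimensional ℝ E]
    {H : Type*} [TopologicalSpace H] {I : ModelWithCorners ℝ E H} [I.Boundaryless]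
    {G : Type*} [TopologicalSpace G] [ChartedSpace H G] [CommGroup G] [LieGroup I ∞ G]
    (g : Bundle.ContMDiffRiemannianMetric I ∞ E (fun x : G ↦ TangentSpace I x))
    (hg : IsBiInvariantMetric g)
    (p q : G) (γ : ℝ → G) (hγ : IsGeodesic g γ) (hp : γ 0 = p) (hq : γ 1 = q)
    (u : TangentSpace I p) (b : TangentBundle I G) :
    IsParallelTransport g γ ⟨p, u⟩ b ↔
      b = ⟨q * p⁻¹ * p, mfderiv I I (fun x : G ↦ q * p⁻¹ * x) p u⟩ := by
  subst hp hq
  let u₀ : E := u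
  have hW : ∀ w : E, IsParallelAlong g γ fun t ↦ leftTranslationDeriv I (γ t * (γ 0)⁻¹) (γ 0) w :=
    isParallelAlong_leftTranslationDeriv hg hγ.smooth (γ 0)
  have hW₀ : ∀ w : E, leftTranslationDeriv I (γ 0 * (γ 0)⁻¹) (γ 0) w = w := fun w ↦ by
    rw [mul_inv_cancel, leftTranslationDeriv_one]
    rfl
  have hend : γ 1 = γ 1 * (γ 0)⁻¹ * γ 0 := by group
  constructor
  · rintro ⟨V, hV, h0, rfl⟩
    let V' : ℝ → E := V
    have hV0 : V' 0 = u₀ := eq_of_heq (Bundle.TotalSpace.mk.inj h0).2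
    refine totalSpace_mk_eq hend (u := V' 1) (metric_ext g (γ 1) fun w ↦ ?_)
    -- Left translation back to `γ 0` inverts the differential, so every test vector at `γ 1` is the
    -- end value of a left-invariant parallel field.
    obtain ⟨w, rfl⟩ : ∃ w₀ : E, leftTranslationDeriv I (γ 1 * (γ 0)⁻¹) (γ 0) w₀ = w := by
      refine ⟨leftTranslationDeriv I (γ 0 * (γ 1)⁻¹) (γ 1) w, ?_⟩
      have h := leftTranslationDeriv_mul (I := I) (γ 1 * (γ 0)⁻¹) (γ 0 * (γ 1)⁻¹) (γ 1)
      have h1 : γ 1 * (γ 0)⁻¹ * (γ 0 * (γ 1)⁻¹) = 1 := by group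
      rw [h1, inv_mul_cancel_right, leftTranslationDeriv_one] at h
      exact congrArg (fun L : E →L[ℝ] E ↦ L w) h.symm
    have h1 := IsParallelAlong.inner_eq hg hγ.smooth (V := V') hV (hW w)
    have h2 := IsParallelAlong.inner_eq hg hγ.smooth (hW u₀) (hW w)
    rw [hV0, hW₀] at h1
    rw [hW₀, hW₀] at h2
    exact h1.trans h2.symm
  · rintro rfl
    exact ⟨_, hW u, totalSpace_mk_eq rfl (hW₀ u), totalSpace_mk_eq hend rfl⟩
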